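/- Let $(M,g)$ be a Riemannian spin manifold of even dimension $m=2n$, with a fixed orientation and spin structure $\mathrm{Spin}(M)$, and let $\Sigma M$ be its complex spinor bundle, with Clifford multiplication satisfying $X\cdot X\cdot\psi=-g(X,X)\psi$ and with the chiral decomposition $\Sigma M=\Sigma^+M\oplus\Sigma^-M$ into the $\pm1$-eigenbundles of the complex volume element $i^{n}e_1\cdots e_{2n}$. Let $G$ be a compact Lie group with an $\mathrm{Ad}$-invariant inner product on its Lie algebra $\mathfrak g$, let $G\to P\to M$ be a smooth principal $G$-bundle, $\rho\colon G\to \mathrm U(V)$ a smooth finite-dimensional unitary representation, $E=P\times_\rho V$ the associated Hermitian vector bundle and $\mathrm{ad}(P)=P\times_{\mathrm{Ad}}\mathfrak g$ the adjoint bundle. The Dirac current of a twisted spinor $\Psi\in\Gamma(\Sigma M\otimes E)$ is the $\mathrm{ad}(P)$-valued one-form $J(\Psi)$ given in local orthonormal frames $(e_k)$ of $TM$ and $(\sigma_\alpha)$ of $\mathrm{ad}(P)$ by $$J(\Psi)=-\frac12\sum_{k=1}^{m}\sum_{\alpha=1}^{\dim\mathfrak g}\langle\Psi,\ e_k\cdot\rho_*(\sigma_\alpha)\Psi\rangle\,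 e^k\otimes\sigma_\alpha ,$$ where $e_k$ acts on $\Sigma M$ by Clifford multiplication and $\rho_*(\sigma_\alpha)$ acts on $E$. If $\Psi\in\Gamma(\Sigma^+M\otimes E)$ or $\Psi\in\Gamma(\Sigma^-M\otimes E)$, then $J(\Psi)=0$. More precisely, at every point $x\in M$ one has $\langle\Psi(x),\ X\cdot\rho_*(\sigma)\Psi(x)\rangle=0$ for all $X\in T_xM$ and all $\sigma\in\mathrm{ad}(P)_x$. -/

import Mathlib

open scoped Manifold ContDiff TensorProduct InnerProductSpace Bundle

noncomputable section

namespace DiracCurrent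

attribute [local instance 2000] InnerProductSpace.toInner

/-! ### The spin group and the complex spinor module in even dimension `2 n` -/

/-- Euclidean space of dimension `2 n`. -/
abbrev Euc (n : ℕ) : Type := EuclideanSpace ℝ (Fin (2 * n))

/-- The quadratic form `v ↦ -|v|²`; its Clifford algebra has the relation `v * v = -|v|²`. -/
def cliffordForm (n : ℕ) : QuadraticForm ℝ (Euc n) :=
  -(LinearMap.BilinMap.toQuadraticMap (innerₗ (Euc n)))

lemma cliffordForm_apply (n : ℕ) (v : Euc n) : cliffordForm n v = -inner ℝ v v := rfl

/-- The real Clifford algebra of Euclidean space of dimension `2 n`. -/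
abbrev Cl (n : ℕ) : Type := CliffordAlgebra (cliffordForm n)

/-- The canonical topology of the (finite-dimensional) real Clifford algebra. -/
instance (n : ℕ) : TopologicalSpace (Cl n) := moduleTopology ℝ (Cl n)

/-- The group `Spin(2 n)`, with the topology of a subspace of the Clifford algebra. -/
abbrev Spin (n : ℕ) : Type := spinGroup (cliffordForm n)

/-- The Hermitian vector space underlying the complex spinor module, of dimension `2 ^ n`. -/
abbrev Spinor (n : ℕ) : Type := EuclideanSpace ℂ (Finset (Fin n))

/-- For `k < 2 n`, the index `⌊k / 2⌋ < n`. -/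
def half {n : ℕ} (k : Fin (2 * n)) : Fin n := ⟨k.1 / 2, by omega⟩

/-- The sign `-1` if `i ∈ S` and `1` otherwise. -/
def occ {n : ℕ} (i : Fin n) (S : Finset (Fin n)) : ℂ := if i ∈ S then -1 else 1

/-- The Jordan-Wigner sign `(-1) ^ #{i ∈ S | i < j}`. -/
def jwSign {n : ℕ} (j : Fin n) (S : Finset (Fin n)) : ℂ := ∏ i ∈ Finset.Iio j, occ i S

/-- The matrix entries of Clifford multiplication by the `k`-th standard basis vector. -/
def gammaCoeff {n : ℕ} (k : Fin (2 * n)) (S : Finset (Fin n)) : ℂ :=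
  jwSign (half k) S * (if k.1 % 2 = 0 then Complex.I else occ (half k) S)

/-- Clifford multiplication by the `k`-th standard basis vector on the spinor module. -/
def gamma {n : ℕ} (k : Fin (2 * n)) : Spinor n →ₗ[ℂ] Spinor n where
  toFun ψ := WithLp.toLp 2 fun S => gammaCoeff k S * ψ (symmDiff S {half k})
  map_add' ψ φ := by ext S; simp [mul_add]
  map_smul' c ψ := by ext S; simp [mul_left_comm]

lemma gamma_apply {n : ℕ} (k : Fin (2 * n)) (ψ : Spinor n) (S : Finset (Fin n)) :
    gamma k ψ S = gammaCoeff k S * ψ (symmDiff S {half k}) := rfl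

lemma occ_symmDiff {n : ℕ} (i j : Fin n) (S : Finset (Fin n)) :
    occ i (symmDiff S {j}) = (if i = j then -1 else 1) * occ i S := by
  unfold occ
  by_cases h : i = j <;> by_cases h' : i ∈ S <;> simp_all [Finset.mem_symmDiff]

lemma occ_mul_self {n : ℕ} (i : Fin n) (S : Finset (Fin n)) : occ i S * occ i S = 1 := by
  unfold occ; split_ifs <;> simp

lemma jwSign_symmDiff {n : ℕ} (i j : Fin n) (S : Finset (Fin n)) :
    jwSign i (symmDiff S {j}) = (if j < i then -1 else 1) * jwSign i S := by
  simp only [jwSign, occ_symmDiff, Finset.prod_mul_distrib, Finset.prod_ite_eq', Finset.mem_Iio]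

lemma jwSign_mul_self {n : ℕ} (i : Fin n) (S : Finset (Fin n)) :
    jwSign i S * jwSign i S = 1 := by
  simp [jwSign, ← Finset.prod_mul_distrib, occ_mul_self]

lemma gamma_anticomm {n : ℕ} (k l : Fin (2 * n)) :
    gamma k * gamma l + gamma l * gamma k = (if k = l then (-2 : ℂ) else 0) • 1 := by
  refine LinearMap.ext fun ψ => ?_
  ext S
  have hkl : k = l ↔ half k = half l ∧ k.1 % 2 = l.1 % 2 := by
    simp only [half, Fin.ext_iff]; omega
  have hS : symmDiff (symmDiff S {half l}) {half k} = symmDiff (symmDiff S {half k}) {half l} := by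
    rw [symmDiff_right_comm]
  have h1 := jwSign_mul_self (half k) S
  have h2 := occ_mul_self (half k) S
  have hI := Complex.I_mul_I
  simp only [LinearMap.add_apply, Module.End.mul_apply, PiLp.add_apply, gamma_apply,
    LinearMap.smul_apply, Module.End.one_apply, PiLp.smul_apply, smul_eq_mul, gammaCoeff,
    jwSign_symmDiff, occ_symmDiff, hS]
  rcases lt_trichotomy (half k) (half l) with h | h | h
  · have : k ≠ l := fun e => by simp [e] at h
    simp only [this, h, h.ne, h.ne', h.not_gt, if_true, if_false]
    split_ifs <;> ring
  · have hss : symmDiff (symmDiff S {half l}) {half l} = S := by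
      rw [symmDiff_symmDiff_cancel_right]
    simp only [h] at h1 h2 ⊢
    rw [hss]
    rcases Nat.mod_two_eq_zero_or_one k.1 with hk | hk <;>
    rcases Nat.mod_two_eq_zero_or_one l.1 with hl | hl <;>
    simp only [hkl, h, hk, hl, lt_irrefl, if_true, if_false, true_and, zero_ne_one, one_ne_zero,
      one_mul, zero_mul]
    · linear_combination (2 * Complex.I * Complex.I * ψ S) * h1 + 2 * ψ S * hI
    · ring
    · ring
    · linear_combination (-2 * occ (half l) S * occ (half l) S * ψ S) * h1 - 2 * ψ S * h2
  · have : k ≠ l := fun e => by simp [e] at h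
    simp only [this, h, h.ne, h.ne', h.not_gt, if_true, if_false]
    split_ifs <;> ring

lemma gamma_skew {n : ℕ} (k : Fin (2 * n)) (ψ φ : Spinor n) :
    inner ℂ (gamma k ψ) φ = -inner ℂ ψ (gamma k φ) := by
  simp only [PiLp.inner_apply, gamma_apply, RCLike.inner_apply, ← Finset.sum_neg_distrib]
  let e : Finset (Fin n) ≃ Finset (Fin n) :=
    Function.Involutive.toPerm (fun S => symmDiff S {half k})
      (fun S => symmDiff_symmDiff_cancel_right _ _)
  rw [← e.sum_comp]
  refine Finset.sum_congr rfl fun S _ => ?_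
  have he : e S = symmDiff S {half k} := rfl
  have hj : ∀ (j : Fin n) (T : Finset (Fin n)), (starRingEnd ℂ) (occ j T) = occ j T := by
    intro j T; unfold occ; split_ifs <;> simp
  have hj' : ∀ (j : Fin n) (T : Finset (Fin n)), (starRingEnd ℂ) (jwSign j T) = jwSign j T := by
    intro j T; simp [jwSign, map_prod, hj]
  have hc : (starRingEnd ℂ) (gammaCoeff k (symmDiff S {half k})) = -gammaCoeff k S := by
    simp only [gammaCoeff, jwSign_symmDiff, occ_symmDiff, lt_irrefl, if_false, if_true, map_mul,
      hj', one_mul]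
    split_ifs <;> simp [hj]
  rw [he, symmDiff_symmDiff_cancel_right, map_mul, hc]
  ring

/-- Clifford multiplication of spinors by vectors of Euclidean space. -/
def cliffordMul (n : ℕ) : Euc n →ₗ[ℝ] Module.End ℂ (Spinor n) where
  toFun v := ∑ k, v k • gamma k
  map_add' v w := by simp [add_smul, Finset.sum_add_distrib]
  map_smul' c v := by simp [mul_smul, Finset.smul_sum]

lemma cliffordMul_apply (n : ℕ) (v : Euc n) : cliffordMul n v = ∑ k, v k • gamma k := rfl

lemma cliffordMul_sq (n : ℕ) (v : Euc n) :
    cliffordMul n v * cliffordMul n v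
      = algebraMap ℝ (Module.End ℂ (Spinor n)) (cliffordForm n v) := by
  have h2 : (2 : ℝ) • (cliffordMul n v * cliffordMul n v)
      = (2 : ℝ) • algebraMap ℝ (Module.End ℂ (Spinor n)) (cliffordForm n v) := by
    have e1 : cliffordMul n v * cliffordMul n v
        = ∑ k, ∑ l, (v k * v l) • (gamma k * gamma l) := by
      rw [cliffordMul_apply, Finset.sum_mul_sum]
      refine Finset.sum_congr rfl fun k _ => Finset.sum_congr rfl fun l _ => ?_
      rw [smul_mul_smul_comm]
    have e2 : cliffordMul n v * cliffordMul n v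
        = ∑ k, ∑ l, (v k * v l) • (gamma l * gamma k) := by
      rw [e1, Finset.sum_comm]
      refine Finset.sum_congr rfl fun k _ => Finset.sum_congr rfl fun l _ => ?_
      rw [mul_comm (v l)]
    rw [two_smul]
    nth_rewrite 1 [e1]
    rw [e2]
    simp only [← Finset.sum_add_distrib, ← smul_add, gamma_anticomm]
    have e3 : ∀ k l : Fin (2 * n), (v k * v l) • ((if k = l then (-2 : ℂ) else 0) •
        (1 : Module.End ℂ (Spinor n)))
        = if k = l then (-2 * (v k * v k)) • (1 : Module.End ℂ (Spinor n)) else 0 := by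
      intro k l
      split_ifs with h
      · subst h
        ext ψ S
        simp
        ring
      · simp
    simp only [e3, Finset.sum_ite_eq, Finset.mem_univ, if_true]
    rw [← Finset.sum_smul, Algebra.algebraMap_eq_smul_one, smul_smul, cliffordForm_apply,
      ← Finset.mul_sum]
    congr 1
    simp only [PiLp.inner_apply, RCLike.inner_apply, conj_trivial]
    ring
  exact smul_right_injective _ (two_ne_zero) h2

lemma cliffordMul_skew (n : ℕ) (v : Euc n) (ψ φ : Spinor n) :
    inner ℂ (cliffordMul n v ψ) φ = -inner ℂ ψ (cliffordMul n v φ) := by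
  simp only [cliffordMul_apply, LinearMap.sum_apply, LinearMap.smul_apply, sum_inner, inner_sum,
    ← Finset.sum_neg_distrib]
  refine Finset.sum_congr rfl fun k _ => ?_
  have h : ∀ χ : Spinor n, v k • χ = (v k : ℂ) • χ := fun χ => by
    ext S; simp
  rw [h, h, inner_smul_left, inner_smul_right, gamma_skew]
  simp

/-- The spinor module as a module over the Clifford algebra. -/
def cliffordRep (n : ℕ) : Cl n →ₐ[ℝ] Module.End ℂ (Spinor n) :=
  CliffordAlgebra.lift (cliffordForm n) ⟨cliffordMul n, cliffordMul_sq n⟩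

lemma cliffordRep_ι (n : ℕ) (v : Euc n) :
    cliffordRep n (CliffordAlgebra.ι (cliffordForm n) v) = cliffordMul n v := by
  simp [cliffordRep]

lemma cliffordRep_star (n : ℕ) (a : Cl n) (ψ φ : Spinor n) :
    inner ℂ (cliffordRep n a ψ) φ = inner ℂ ψ (cliffordRep n (star a) φ) := by
  induction a using CliffordAlgebra.induction generalizing ψ φ with
  | algebraMap r =>
    have h : ∀ χ : Spinor n, r • χ = (r : ℂ) • χ := fun χ => by
      ext S; simp
    rw [CliffordAlgebra.star_algebraMap, AlgHom.commutes, Module.algebraMap_end_apply,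
      Module.algebraMap_end_apply, h, h, inner_smul_left, inner_smul_right, Complex.conj_ofReal]
  | ι v => simp [cliffordRep_ι, cliffordMul_skew]
  | mul a b ha hb => simp [Module.End.mul_apply, ha, hb]
  | add a b ha hb =>
    rw [map_add, star_add, map_add, LinearMap.add_apply, LinearMap.add_apply, inner_add_left,
      inner_add_right, ha, hb]

/-- The (unitary, complex) spinor representation of `Spin(2 n)`. -/
def spinRep (n : ℕ) : Spin n →* (Spinor n ≃ₗᵢ[ℂ] Spinor n) where
  toFun a :=
    LinearEquiv.isometryOfInner
      (LinearEquiv.ofLinearMap (cliffordRep n a) (cliffordRep n (star (a : Cl n)))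
        (by rw [← Module.End.mul_eq_comp, ← map_mul, spinGroup.mul_star_self_of_mem a.2, map_one]
            rfl)
        (by rw [← Module.End.mul_eq_comp, ← map_mul, spinGroup.star_mul_self_of_mem a.2, map_one]
            rfl))
      (fun ψ φ => by
        change inner ℂ (cliffordRep n a ψ) (cliffordRep n a φ) = _
        rw [cliffordRep_star, ← Module.End.mul_apply, ← map_mul,
          spinGroup.star_mul_self_of_mem a.2, map_one, Module.End.one_apply])
  map_one' := by
    ext1 ψ
    change cliffordRep n ((1 : Spin n) : Cl n) ψ = ψ
    simp
  map_mul' a b := by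
    ext1 ψ
    change cliffordRep n ((a * b : Spin n) : Cl n) ψ = cliffordRep n a (cliffordRep n b ψ)
    simp [Module.End.mul_apply]

lemma spinRep_apply (n : ℕ) (a : Spin n) (ψ : Spinor n) :
    spinRep n a ψ = cliffordRep n a ψ := rfl

lemma ι_injective (n : ℕ) : Function.Injective (CliffordAlgebra.ι (cliffordForm n)) := by
  rw [← LinearMap.ker_eq_bot, LinearMap.ker_eq_bot']
  intro v hv
  have h := cliffordMul_sq n v
  rw [← cliffordRep_ι, hv, map_zero, zero_mul, cliffordForm_apply] at h
  have h1 := (algebraMap ℝ (Module.End ℂ (Spinor n))).injective (h.symm.trans (map_zero _).symm)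
  rwa [neg_eq_zero, inner_self_eq_zero] at h1

lemma spin_conj_mem (n : ℕ) (a : Spin n) (v : Euc n) :
    (a : Cl n) * CliffordAlgebra.ι (cliffordForm n) v * star (a : Cl n)
      ∈ LinearMap.range (CliffordAlgebra.ι (cliffordForm n)) := by
  have h := spinGroup.conjAct_smul_ι_mem_range_ι (Q := cliffordForm n)
    (x := spinGroup.toUnits a) a.2 v
  rwa [ConjAct.units_smul_def] at h

/-- The covering homomorphism `Spin(2 n) → SO(2 n)`, `v ↦ a v a⁻¹`. -/
def spinRot (n : ℕ) (a : Spin n) : Euc n →ₗ[ℝ] Euc n :=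
  (LinearEquiv.ofInjective _ (ι_injective n)).symm.toLinearMap ∘ₗ
    LinearMap.codRestrict _
      (LinearMap.mulLeft ℝ (a : Cl n) ∘ₗ LinearMap.mulRight ℝ (star (a : Cl n)) ∘ₗ
        CliffordAlgebra.ι (cliffordForm n))
      (fun v => by simpa [mul_assoc] using spin_conj_mem n a v)

lemma ι_spinRot (n : ℕ) (a : Spin n) (v : Euc n) :
    CliffordAlgebra.ι (cliffordForm n) (spinRot n a v)
      = a * CliffordAlgebra.ι (cliffordForm n) v * star (a : Cl n) := by
  have h := LinearEquiv.apply_symm_apply (LinearEquiv.ofInjective _ (ι_injective n))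
    (LinearMap.codRestrict _
      (LinearMap.mulLeft ℝ (a : Cl n) ∘ₗ LinearMap.mulRight ℝ (star (a : Cl n)) ∘ₗ
        CliffordAlgebra.ι (cliffordForm n))
      (fun v => by simpa [mul_assoc] using spin_conj_mem n a v) v)
  have h' := congrArg Subtype.val h
  rw [LinearEquiv.ofInjective_apply] at h'
  refine h'.trans ?_
  simp [mul_assoc]

/-- The complex volume element `iⁿ e₁ ⋯ e₂ₙ` acting on spinors. -/
def chirality (n : ℕ) : Module.End ℂ (Spinor n) :=
  Complex.I ^ n • (List.ofFn fun k => cliffordMul n (EuclideanSpace.single k 1)).prod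

/-- The half-spinor spaces `Σ⁺` (`ε = 1`) and `Σ⁻` (`ε = -1`): the eigenspaces of the complex
volume element. -/
def chiralSpinors (n : ℕ) (ε : ℤˣ) : Submodule ℂ (Spinor n) :=
  Module.End.eigenspace (chirality n) ((ε : ℤ) : ℂ)

/-! ### Principal bundles and associated bundles -/

section Principal

variable (G P M : Type*) [TopologicalSpace G] [Group G] [TopologicalSpace P] [TopologicalSpace M]

/-- A local trivialization `π⁻¹(U) ≃ U × G` of a space `P` over `M` with right `G`-action: it
covers the identity of the open set `U` and is equivariant. -/
structure IsLocalTrivialization {G P M : Type*} [TopologicalSpace G] [Group G]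
    [TopologicalSpace P] [TopologicalSpace M] (proj : P → M) (act : P → G → P)
    (φ : OpenPartialHomeomorph P (M × G)) (U : Set M) : Prop where
  isOpen : IsOpen U
  source_eq : φ.source = proj ⁻¹' U
  target_eq : φ.target = U ×ˢ Set.univ
  fst_eq : ∀ p, proj p ∈ U → (φ p).1 = proj p
  equivariant : ∀ p g, proj p ∈ U → act p g ∈ φ.source ∧ φ (act p g) = ((φ p).1, (φ p).2 * g)

/-- A (topological) principal `G`-bundle `P → M`, with right action of `G` on `P`. -/
structure PrincipalBundle where
  proj : P → M
  act : P → G → P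
  act_one : ∀ p, act p 1 = p
  act_mul : ∀ p g h, act (act p g) h = act p (g * h)
  exists_trivialization : ∀ x : M, ∃ (φ : OpenPartialHomeomorph P (M × G)) (U : Set M),
    x ∈ U ∧ IsLocalTrivialization proj act φ U

end Principal

namespace PrincipalBundle

variable {G P M : Type*} [TopologicalSpace G] [Group G] [TopologicalSpace P] [TopologicalSpace M]
  (B : PrincipalBundle G P M)

lemma proj_act (p : P) (g : G) : B.proj (B.act p g) = B.proj p := by
  obtain ⟨φ, U, hU, h⟩ := B.exists_trivialization (B.proj p)
  obtain ⟨h1, h2⟩ := h.equivariant p g hU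
  rw [h.source_eq] at h1
  rw [← h.fst_eq _ h1, h2, h.fst_eq p hU]

/-- The fibre `P_x`. -/
def Fiber (x : M) : Type _ := {p : P // B.proj p = x}

variable {B}

/-- The right action of `G` on the fibre `P_x`. -/
def Fiber.act {x : M} (p : B.Fiber x) (g : G) : B.Fiber x :=
  ⟨B.act p.1 g, (B.proj_act p.1 g).trans p.2⟩

lemma Fiber.act_one {x : M} (p : B.Fiber x) : p.act 1 = p := Subtype.ext (B.act_one _)

lemma Fiber.act_mul {x : M} (p : B.Fiber x) (g h : G) : (p.act g).act h = p.act (g * h) :=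
  Subtype.ext (B.act_mul _ _ _)

lemma Fiber.nonempty (x : M) : Nonempty (B.Fiber x) := by
  obtain ⟨φ, U, hU, h⟩ := B.exists_trivialization x
  have ht : (x, (1 : G)) ∈ φ.target := by rw [h.target_eq]; exact ⟨hU, trivial⟩
  have hs := φ.map_target ht
  rw [h.source_eq] at hs
  refine ⟨⟨φ.symm (x, 1), ?_⟩⟩
  rw [← h.fst_eq _ hs, φ.right_inv ht]

lemma Fiber.exists_act_eq {x : M} (p q : B.Fiber x) : ∃ g : G, p.act g = q := by
  obtain ⟨φ, U, hU, h⟩ := B.exists_trivialization x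
  have hp : B.proj p.1 ∈ U := by rw [p.2]; exact hU
  have hq : B.proj q.1 ∈ U := by rw [q.2]; exact hU
  refine ⟨(φ p.1).2⁻¹ * (φ q.1).2, Subtype.ext ?_⟩
  obtain ⟨h1, h2⟩ := h.equivariant p.1 ((φ p.1).2⁻¹ * (φ q.1).2) hp
  refine φ.injOn h1 (by rw [h.source_eq]; exact hq) ?_
  change φ (B.act p.1 _) = _
  rw [h2, mul_inv_cancel_left]
  exact Prod.ext (by rw [h.fst_eq _ hp, h.fst_eq _ hq, p.2, q.2]) rfl

lemma Fiber.act_injective {x : M} (p : B.Fiber x) : Function.Injective p.act := by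
  intro g h hgh
  obtain ⟨φ, U, hU, ht⟩ := B.exists_trivialization x
  have hp : B.proj p.1 ∈ U := by rw [p.2]; exact hU
  have h1 := (ht.equivariant p.1 g hp).2
  have h2 := (ht.equivariant p.1 h hp).2
  have h3 : B.act p.1 g = B.act p.1 h := congrArg Subtype.val hgh
  rw [h3, h2] at h1
  exact (mul_left_cancel (congrArg Prod.snd h1)).symm

end PrincipalBundle

section Assoc

variable {𝕜 : Type*} [RCLike 𝕜] {V : Type*} [NormedAddCommGroup V] [InnerProductSpace 𝕜 V]
  {G P M : Type*} [TopologicalSpace G] [Group G] [TopologicalSpace P] [TopologicalSpace M]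

/-- The equivariant functions `f : P_x → V`, `f (p g) = ρ(g)⁻¹ f (p)`. -/
def assocSubmodule (B : PrincipalBundle G P M) (ρ : G →* (V ≃ₗᵢ[𝕜] V)) (x : M) :
    Submodule 𝕜 (B.Fiber x → V) where
  carrier := {f | ∀ p g, f (p.act g) = ρ g⁻¹ (f p)}
  add_mem' hf hh p g := by simp only [Pi.add_apply, map_add, hf p g, hh p g]
  zero_mem' p g := by simp
  smul_mem' c f hf p g := by simp only [Pi.smul_apply, map_smul, hf p g]

/-- The fibre over `x` of the associated bundle `P ×_ρ V`, for an isometric representation `ρ`.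
The class `[p, v]` is the equivariant function `P_x → V` that maps `p g` to `ρ(g)⁻¹ v`, see
`AssocFiber.mk`; every element is of this form, for every `p`. -/
def AssocFiber (B : PrincipalBundle G P M) (ρ : G →* (V ≃ₗᵢ[𝕜] V)) (x : M) : Type _ :=
  assocSubmodule B ρ x

namespace AssocFiber

variable {B : PrincipalBundle G P M} {ρ : G →* (V ≃ₗᵢ[𝕜] V)} {x : M}

instance : CoeFun (AssocFiber B ρ x) (fun _ => B.Fiber x → V) := ⟨fun f => f.1⟩

lemma equivariant (f : AssocFiber B ρ x) (p : B.Fiber x) (g : G) :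
    f (p.act g) = ρ g⁻¹ (f p) := f.2 p g

lemma ext_of_eq (f h : AssocFiber B ρ x) (p : B.Fiber x) (hp : f p = h p) : f = h := by
  refine Subtype.ext (funext fun q => ?_)
  obtain ⟨g, rfl⟩ := p.exists_act_eq q
  rw [equivariant, equivariant, hp]

/-- The Hermitian (or Euclidean) bundle metric `⟨[p, v], [p, w]⟩ = ⟨v, w⟩`. -/
@[reducible]
def core : @InnerProductSpace.Core 𝕜 (assocSubmodule B ρ x) _ _ _ where
  inner f h := inner 𝕜 (f.1 (Classical.choice (PrincipalBundle.Fiber.nonempty x)))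
    (h.1 (Classical.choice (PrincipalBundle.Fiber.nonempty x)))
  conj_inner_symm _ _ := inner_conj_symm _ _
  re_inner_nonneg _ := inner_self_nonneg
  add_left _ _ _ := inner_add_left _ _ _
  smul_left _ _ _ := inner_smul_left _ _ _
  definite f hf := ext_of_eq (f : AssocFiber B ρ x) ⟨0, _⟩ _ (inner_self_eq_zero.1 hf)

instance : NormedAddCommGroup (AssocFiber B ρ x) :=
  (core (B := B) (ρ := ρ) (x := x)).toNormedAddCommGroup

instance : InnerProductSpace 𝕜 (AssocFiber B ρ x) :=
  InnerProductSpace.ofCore (core (B := B) (ρ := ρ) (x := x)).toCore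

lemma inner_eq (f h : AssocFiber B ρ x) (p : B.Fiber x) :
    inner 𝕜 f h = inner 𝕜 (f p) (h p) := by
  obtain ⟨g, hg⟩ := p.exists_act_eq (Classical.choice (PrincipalBundle.Fiber.nonempty x))
  change inner 𝕜 (f (Classical.choice _)) (h (Classical.choice _)) = _
  rw [← hg, equivariant, equivariant, LinearIsometryEquiv.inner_map_map]

/-- Evaluation at a frame `p ∈ P_x`: the inverse of `v ↦ [p, v]`. -/
def eval (p : B.Fiber x) : AssocFiber B ρ x →ₗ[𝕜] V where
  toFun f := f p
  map_add' _ _ := rfl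
  map_smul' _ _ := rfl

lemma eval_injective (p : B.Fiber x) :
    Function.Injective (eval p : AssocFiber B ρ x →ₗ[𝕜] V) :=
  fun f h hfh => ext_of_eq f h p hfh

/-- The class `[p, v]` in the associated bundle. -/
def mk (p : B.Fiber x) (v : V) : AssocFiber B ρ x :=
  ⟨fun q => ρ (p.exists_act_eq q).choose⁻¹ v, fun q g => by
    have h : (p.exists_act_eq (q.act g)).choose = (p.exists_act_eq q).choose * g := by
      apply p.act_injective
      rw [(p.exists_act_eq (q.act g)).choose_spec, ← p.act_mul, (p.exists_act_eq q).choose_spec]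
    beta_reduce
    rw [h, mul_inv_rev, map_mul]; rfl⟩

lemma eval_mk (p : B.Fiber x) (v : V) : eval p (mk p v : AssocFiber B ρ x) = v := by
  have h : (p.exists_act_eq p).choose = 1 := by
    apply p.act_injective
    rw [(p.exists_act_eq p).choose_spec, p.act_one]
  change ρ (p.exists_act_eq p).choose⁻¹ v = v
  rw [h, inv_one, map_one]; rfl

lemma mk_act (p : B.Fiber x) (g : G) (v : V) :
    (mk (p.act g) v : AssocFiber B ρ x) = mk p (ρ g v) := by
  refine ext_of_eq _ _ (p.act g) ?_
  rw [equivariant (mk p _)]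
  change eval _ (mk (p.act g) v : AssocFiber B ρ x)
    = ρ g⁻¹ (eval p (mk p (ρ g v) : AssocFiber B ρ x))
  rw [eval_mk, eval_mk, map_inv]
  exact ((ρ g).symm_apply_apply v).symm

instance [FiniteDimensional 𝕜 V] : FiniteDimensional 𝕜 (AssocFiber B ρ x) :=
  FiniteDimensional.of_injective
    (eval (Classical.choice (PrincipalBundle.Fiber.nonempty x)) : AssocFiber B ρ x →ₗ[𝕜] V)
    (eval_injective _)

end AssocFiber

end Assoc

/-! ### Spin structures on Riemannian manifolds and spinor bundles -/

section Spin


variable (n : ℕ) (M : Type*) [TopologicalSpace M] [ChartedSpace (Euc n) M]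
  [IsManifold (𝓡 (2 * n)) ∞ M]

/-- An orientation of a manifold: orientations of all tangent spaces such that locally there are
smooth positively oriented frames. -/
structure ManifoldOrientation where
  at_ : ∀ x : M, Orientation ℝ (TangentSpace (𝓡 (2 * n)) x) (Fin (2 * n))
  exists_frame : ∀ x : M, ∃ U : Set M, IsOpen U ∧ x ∈ U ∧
    ∃ e : Fin (2 * n) → ∀ y : M, TangentSpace (𝓡 (2 * n)) y,
      (∀ i, ContMDiffOn (𝓡 (2 * n)) (𝓡 (2 * n)).tangent ∞
        (fun y => (⟨y, e i y⟩ : TangentBundle (𝓡 (2 * n)) M)) U) ∧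
      ∀ y ∈ U, ∃ b : Module.Basis (Fin (2 * n)) ℝ (TangentSpace (𝓡 (2 * n)) y),
        (∀ i, b i = e i y) ∧ b.orientation = at_ y

variable {n M}
variable [Bundle.RiemannianBundle (fun x : M => TangentSpace (𝓡 (2 * n)) x)]

/-- The total space `SO(M, g)` of oriented orthonormal frames. -/
structure OrientedFrame (o : ManifoldOrientation n M) where
  base : M
  frame : OrthonormalBasis (Fin (2 * n)) ℝ (TangentSpace (𝓡 (2 * n)) base)
  oriented : frame.toBasis.orientation = o.at_ base

namespace OrientedFrame

variable {o : ManifoldOrientation n M}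

/-- The tangent vector `∑ vᵢ eᵢ` with coordinates `v` in the frame `(e₁, …, e₂ₙ)`. -/
def vec (F : OrientedFrame o) (v : Euc n) : TangentBundle (𝓡 (2 * n)) M :=
  ⟨F.base, F.frame.repr.symm v⟩

/-- The topology of `SO(M, g)`, as a space of tuples of tangent vectors. -/
instance : TopologicalSpace (OrientedFrame o) :=
  TopologicalSpace.induced
    (fun F => (F.base, fun i => F.vec (EuclideanSpace.single i 1)) :
      OrientedFrame o → M × (Fin (2 * n) → TangentBundle (𝓡 (2 * n)) M)) inferInstance

/-- A frame with base point `x`, as an orthonormal basis of `T_x M`. -/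
def at_ (F : OrientedFrame o) {x : M} (h : F.base = x) :
    OrthonormalBasis (Fin (2 * n)) ℝ (TangentSpace (𝓡 (2 * n)) x) := h ▸ F.frame

lemma vec_at (F : OrientedFrame o) {x : M} (h : F.base = x) (v : Euc n) :
    F.vec v = ⟨x, (F.at_ h).repr.symm v⟩ := by
  subst h; rfl

end OrientedFrame

/-- A spin structure on an oriented Riemannian manifold: a principal `Spin(2 n)`-bundle `Q → M`
with a map `Q → SO(M, g)` over `M` that is equivariant along `Spin(2 n) → SO(2 n)`. -/
structure SpinStructure (o : ManifoldOrientation n M) (Q : Type*) [TopologicalSpace Q] extends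
    PrincipalBundle (Spin n) Q M where
  frame : Q → OrientedFrame o
  continuous_frame : Continuous frame
  base_frame : ∀ q, (frame q).base = proj q
  frame_act : ∀ q a v, (frame (act q a)).vec v = (frame q).vec (spinRot n a v)

variable {o : ManifoldOrientation n M} {Q : Type*} [TopologicalSpace Q]

/-- The fibre `Σ_x M` of the spinor bundle `ΣM = Spin(M) ×_κ Σ`. -/
abbrev SpinorFiber (S : SpinStructure o Q) (x : M) : Type _ :=
  AssocFiber S.toPrincipalBundle (spinRep n) x

namespace SpinStructure

variable (S : SpinStructure o Q)

/-- The orthonormal basis of `T_x M` given by a spin frame `q` at `x`. -/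
def frameAt {x : M} (q : S.Fiber x) :
    OrthonormalBasis (Fin (2 * n)) ℝ (TangentSpace (𝓡 (2 * n)) x) :=
  (S.frame q.1).at_ ((S.base_frame q.1).trans q.2)

lemma frameAt_act {x : M} (q : S.Fiber x) (a : Spin n) (X : TangentSpace (𝓡 (2 * n)) x) :
    (S.frameAt q).repr X = spinRot n a ((S.frameAt (q.act a)).repr X) := by
  have h := S.frame_act q.1 a ((S.frameAt (q.act a)).repr X)
  have h1 := OrientedFrame.vec_at (S.frame (q.act a).1)
    ((S.base_frame (q.act a).1).trans (q.act a).2) ((S.frameAt (q.act a)).repr X)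
  have h2 := OrientedFrame.vec_at (S.frame q.1) ((S.base_frame q.1).trans q.2)
    (spinRot n a ((S.frameAt (q.act a)).repr X))
  have h3 := (h1.symm.trans h).trans h2
  have h4 := eq_of_heq (Bundle.TotalSpace.mk.inj h3).2
  change (S.frameAt (q.act a)).repr.symm _ = (S.frameAt q).repr.symm _ at h4
  rw [LinearIsometryEquiv.symm_apply_apply] at h4
  rw [← LinearIsometryEquiv.apply_symm_apply (S.frameAt q).repr (spinRot n a _), ← h4]

/-- Clifford multiplication by a tangent vector, `X · [q, ψ] = [q, v · ψ]` where `v` are the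
coordinates of `X` in the frame of `q`. -/
def cliffordEnd {x : M} (X : TangentSpace (𝓡 (2 * n)) x) : Module.End ℂ (SpinorFiber S x) where
  toFun ψ := ⟨fun q => cliffordMul n ((S.frameAt q).repr X) (ψ q), fun q a => by
    change cliffordMul n ((S.frameAt (q.act a)).repr X) (ψ (q.act a))
      = spinRep n a⁻¹ (cliffordMul n ((S.frameAt q).repr X) (ψ q))
    rw [S.frameAt_act q a X, ψ.equivariant, ← cliffordRep_ι, ← cliffordRep_ι, ι_spinRot,
      spinRep_apply, spinRep_apply]
    change _ = cliffordRep n (star (a : Cl n)) _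
    change cliffordRep n _ (cliffordRep n (star (a : Cl n)) _) = _
    simp only [← Module.End.mul_apply, ← map_mul, ← mul_assoc,
      spinGroup.star_mul_self_of_mem a.2, one_mul]⟩
  map_add' ψ φ := Subtype.ext (funext fun q => map_add _ (ψ q) (φ q))
  map_smul' c ψ := Subtype.ext (funext fun q => map_smul _ c (ψ q))

lemma eval_cliffordEnd {x : M} (X : TangentSpace (𝓡 (2 * n)) x) (ψ : SpinorFiber S x)
    (q : S.Fiber x) : AssocFiber.eval q (S.cliffordEnd X ψ)
      = cliffordMul n ((S.frameAt q).repr X) (AssocFiber.eval q ψ) := rfl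

/-- Clifford multiplication `T_x M × Σ_x M → Σ_x M`, linear in the vector. -/
def clifford (x : M) : TangentSpace (𝓡 (2 * n)) x →ₗ[ℝ] Module.End ℂ (SpinorFiber S x) where
  toFun X := S.cliffordEnd X
  map_add' X Y := by
    refine LinearMap.ext fun ψ => ?_
    obtain ⟨q⟩ := PrincipalBundle.Fiber.nonempty (B := S.toPrincipalBundle) x
    apply AssocFiber.eval_injective q
    rw [LinearMap.add_apply, map_add, eval_cliffordEnd, eval_cliffordEnd, eval_cliffordEnd,
      map_add, map_add, LinearMap.add_apply]
  map_smul' c X := by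
    refine LinearMap.ext fun ψ => ?_
    obtain ⟨q⟩ := PrincipalBundle.Fiber.nonempty (B := S.toPrincipalBundle) x
    apply AssocFiber.eval_injective q
    rw [LinearMap.smul_apply, LinearMap.map_smul_of_tower, eval_cliffordEnd, eval_cliffordEnd,
      map_smul, map_smul, LinearMap.smul_apply, RingHom.id_apply]

/-- The fibre `Σ^ε_x M` of the bundle of spinors of chirality `ε = ±1`. -/
def chiral (ε : ℤˣ) (x : M) : Submodule ℂ (SpinorFiber S x) where
  carrier := {ψ | ∀ q : S.Fiber x, ψ q ∈ chiralSpinors n ε}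
  add_mem' hψ hφ q := add_mem (hψ q) (hφ q)
  zero_mem' _ := zero_mem (chiralSpinors n ε)
  smul_mem' c _ hψ q := Submodule.smul_mem _ c (hψ q)

end SpinStructure

end Spin

/-! ### Lie groups, adjoint bundles and associated Hermitian bundles -/

section Lie

variable {EG : Type*} [NormedAddCommGroup EG] [NormedSpace ℝ EG]
  {G : Type*} [TopologicalSpace G] [ChartedSpace EG G] [Group G]

variable (EG) in
/-- The adjoint action `Ad_g` on the Lie algebra: the derivative of `h ↦ g h g⁻¹` at `1`. -/
def adMap (g : G) : GroupLieAlgebra 𝓘(ℝ, EG) G →L[ℝ] GroupLieAlgebra 𝓘(ℝ, EG) G :=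
  show EG →L[ℝ] EG from mfderiv 𝓘(ℝ, EG) 𝓘(ℝ, EG) (fun h : G => g * h * g⁻¹) 1

variable (EG G) in
/-- An `Ad`-invariant inner product on the Lie algebra of `G`. -/
structure AdInvariantMetric where
  form : GroupLieAlgebra 𝓘(ℝ, EG) G →ₗ[ℝ] GroupLieAlgebra 𝓘(ℝ, EG) G →ₗ[ℝ] ℝ
  symm : ∀ A B, form A B = form B A
  pos : ∀ A, A ≠ 0 → 0 < form A A
  ad_inv : ∀ g A B, form (adMap EG g A) (adMap EG g B) = form A B

namespace AdInvariantMetric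

/-- The Lie algebra, as an inner product space. -/
def LieAlg (_b : AdInvariantMetric EG G) : Type _ := GroupLieAlgebra 𝓘(ℝ, EG) G

variable (b : AdInvariantMetric EG G)

@[reducible]
def core : InnerProductSpace.Core ℝ (GroupLieAlgebra 𝓘(ℝ, EG) G) where
  inner A B := b.form A B
  conj_inner_symm A B := b.symm B A
  re_inner_nonneg A := by
    by_cases h : A = 0
    · simp [h]
    · exact (b.pos A h).le
  add_left A B C := by simp
  smul_left A B c := by simp
  definite A h := by
    by_contra hA
    exact (b.pos A hA).ne' h

instance : NormedAddCommGroup b.LieAlg := b.core.toNormedAddCommGroup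

instance : InnerProductSpace ℝ b.LieAlg := InnerProductSpace.ofCore b.core.toCore

instance [FiniteDimensional ℝ EG] : FiniteDimensional ℝ b.LieAlg :=
  inferInstanceAs (FiniteDimensional ℝ EG)

lemma adMap_one : adMap EG (1 : G) = ContinuousLinearMap.id ℝ _ := by
  have e : (fun k : G => 1 * k * (1 : G)⁻¹) = id := by funext k; simp
  unfold adMap
  rw [e]
  exact mfderiv_id (I := 𝓘(ℝ, EG)) (x := (1 : G))

lemma adMap_one_apply (A : GroupLieAlgebra 𝓘(ℝ, EG) G) : adMap EG (1 : G) A = A := by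
  rw [adMap_one]; rfl

variable [LieGroup 𝓘(ℝ, EG) ∞ G]

lemma hasMFDerivAt_conj (g : G) : HasMFDerivAt 𝓘(ℝ, EG) 𝓘(ℝ, EG) (fun h : G => g * h * g⁻¹) 1
    (mfderiv 𝓘(ℝ, EG) 𝓘(ℝ, EG) (fun h : G => g * h * g⁻¹) 1) := by
  have h : ContMDiff 𝓘(ℝ, EG) 𝓘(ℝ, EG) ∞ (fun h : G => g * h * g⁻¹) :=
    (contMDiff_const.mul contMDiff_id).mul contMDiff_const
  exact (h.mdifferentiable (by simp) 1).hasMFDerivAt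

lemma adMap_mul (g h : G) : adMap EG (g * h) = (adMap EG g).comp (adMap EG h) := by
  have h1 : (1 : G) = h * 1 * h⁻¹ := by simp
  have e : (fun k : G => g * h * k * (g * h)⁻¹)
      = (fun k : G => g * k * g⁻¹) ∘ (fun k : G => h * k * h⁻¹) := by
    funext k; simp [mul_assoc]
  have key : ∀ y : G, y = 1 → HasMFDerivAt 𝓘(ℝ, EG) 𝓘(ℝ, EG) (fun k : G => g * k * g⁻¹) y
      (mfderiv 𝓘(ℝ, EG) 𝓘(ℝ, EG) (fun k : G => g * k * g⁻¹) 1 : EG →L[ℝ] EG) := by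
    rintro y rfl; exact hasMFDerivAt_conj g
  have h2 := ((key _ h1.symm).comp 1 (hasMFDerivAt_conj h)).mfderiv
  unfold adMap
  rw [e]
  exact h2

lemma adMap_mul_apply (g h : G) (A : GroupLieAlgebra 𝓘(ℝ, EG) G) :
    adMap EG (g * h) A = adMap EG g (adMap EG h A) := by rw [adMap_mul]; rfl

/-- `Ad_g` as a linear automorphism. -/
def adEquiv (g : G) : b.LieAlg ≃ₗ[ℝ] b.LieAlg where
  toFun A := (adMap EG g : EG →L[ℝ] EG) A
  invFun A := (adMap EG g⁻¹ : EG →L[ℝ] EG) A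
  map_add' A B := map_add (adMap EG g) A B
  map_smul' c A := map_smul (adMap EG g) c A
  left_inv A :=
    (adMap_mul_apply (EG := EG) g⁻¹ g A).symm.trans (by rw [inv_mul_cancel]; exact adMap_one_apply (EG := EG) A)
  right_inv A :=
    (adMap_mul_apply (EG := EG) g g⁻¹ A).symm.trans (by rw [mul_inv_cancel]; exact adMap_one_apply (EG := EG) A)

/-- The adjoint representation, by isometries of the Lie algebra. -/
def adRep : G →* (b.LieAlg ≃ₗᵢ[ℝ] b.LieAlg) where
  toFun g := (b.adEquiv g).isometryOfInner (fun A B => b.ad_inv g A B)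
  map_one' := LinearIsometryEquiv.ext fun A => adMap_one_apply (EG := EG) A
  map_mul' g h := LinearIsometryEquiv.ext fun A => adMap_mul_apply (EG := EG) g h A

end AdInvariantMetric
end Lie

section Rep

variable {EG : Type*} [NormedAddCommGroup EG] [NormedSpace ℝ EG]
  {G : Type*} [TopologicalSpace G] [ChartedSpace EG G] [Group G]
  {V : Type*} [NormedAddCommGroup V] [InnerProductSpace ℂ V]

variable (EG G V) in
/-- A smooth unitary representation `ρ : G → U(V)`. -/
structure UnitaryRep where
  hom : G →* (V ≃ₗᵢ[ℂ] V)
  smooth : ContMDiff 𝓘(ℝ, EG) 𝓘(ℝ, V →L[ℂ] V) ∞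
    (fun g => ((hom g).toContinuousLinearEquiv : V →L[ℂ] V))

namespace UnitaryRep

variable (ρ : UnitaryRep EG G V)

/-- `ρ(g)` as a bounded operator. -/
def op (g : G) : V →L[ℂ] V := (ρ.hom g).toContinuousLinearEquiv

/-- The differential `ρ_* : 𝔤 → End(V)` of a representation. -/
def deriv : GroupLieAlgebra 𝓘(ℝ, EG) G →L[ℝ] (V →L[ℂ] V) :=
  show EG →L[ℝ] (V →L[ℂ] V) from mfderiv 𝓘(ℝ, EG) 𝓘(ℝ, V →L[ℂ] V) ρ.op 1

variable [LieGroup 𝓘(ℝ, EG) ∞ G]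

lemma deriv_adMap (g : G) (A : GroupLieAlgebra 𝓘(ℝ, EG) G) :
    ρ.deriv (adMap EG g A) = (ρ.op g).comp ((ρ.deriv A).comp (ρ.op g⁻¹)) := by
  have key : ∀ y : G, y = 1 → HasMFDerivAt 𝓘(ℝ, EG) 𝓘(ℝ, V →L[ℂ] V) ρ.op y
      (mfderiv 𝓘(ℝ, EG) 𝓘(ℝ, V →L[ℂ] V) ρ.op 1 : EG →L[ℝ] (V →L[ℂ] V)) := by
    rintro y rfl
    exact (ρ.smooth.mdifferentiable (by simp) 1).hasMFDerivAt
  have h1 := (key (g * 1 * g⁻¹) (by simp)).comp 1 (AdInvariantMetric.hasMFDerivAt_conj g)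
  let L : (V →L[ℂ] V) →L[ℝ] (V →L[ℂ] V) :=
    ((ContinuousLinearMap.compL ℂ V V V (ρ.op g)).comp
      ((ContinuousLinearMap.compL ℂ V V V).flip (ρ.op g⁻¹))).restrictScalars ℝ
  have h2 := (L.hasMFDerivAt (x := ρ.op 1)).comp (1 : G) (key 1 rfl)
  have e : ρ.op ∘ (fun h : G => g * h * g⁻¹) = L ∘ ρ.op := by
    funext h
    ext v
    change ρ.hom (g * h * g⁻¹) v = ρ.hom g (ρ.hom h (ρ.hom g⁻¹ v))
    rw [map_mul, map_mul]; rfl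
  rw [e] at h1
  exact congrArg (fun T : EG →L[ℝ] (V →L[ℂ] V) => T A) (hasMFDerivAt_unique h1 h2)

end UnitaryRep

variable [LieGroup 𝓘(ℝ, EG) ∞ G]
  {P M : Type*} [TopologicalSpace P] [TopologicalSpace M]

/-- The fibre over `x` of the adjoint bundle `ad(P) = P ×_Ad 𝔤`. -/
abbrev AdFiber (B : PrincipalBundle G P M) (b : AdInvariantMetric EG G) (x : M) : Type _ :=
  AssocFiber B b.adRep x

/-- The fibre over `x` of the associated Hermitian bundle `E = P ×_ρ V`. -/
abbrev HermFiber (B : PrincipalBundle G P M) (ρ : UnitaryRep EG G V) (x : M) : Type _ :=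
  AssocFiber B ρ.hom x

variable (B : PrincipalBundle G P M) (b : AdInvariantMetric EG G) (ρ : UnitaryRep EG G V)

/-- The endomorphism `ρ_*(σ)` of `E_x` for `σ ∈ ad(P)_x`: `ρ_*([p, A]) [p, v] = [p, ρ_*(A) v]`. -/
def rhoEnd {x : M} (σ : AdFiber B b x) : Module.End ℂ (HermFiber B ρ x) where
  toFun ξ := ⟨fun p => ρ.deriv (σ p) (ξ p), fun p g => by
    change ρ.deriv (σ (p.act g)) (ξ (p.act g)) = ρ.hom g⁻¹ (ρ.deriv (σ p) (ξ p))
    rw [σ.equivariant, ξ.equivariant]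
    refine (congrArg (fun T : V →L[ℂ] V => T (ρ.hom g⁻¹ (ξ p)))
      (ρ.deriv_adMap g⁻¹ (σ p))).trans ?_
    change ρ.hom g⁻¹ (ρ.deriv (σ p) (ρ.hom g⁻¹⁻¹ (ρ.hom g⁻¹ (ξ p)))) = _
    rw [map_inv ρ.hom g⁻¹]
    exact congrArg (fun v => ρ.hom g⁻¹ (ρ.deriv (σ p) v))
      (LinearIsometryEquiv.symm_apply_apply (ρ.hom g⁻¹) (ξ p))⟩
  map_add' ξ ζ := Subtype.ext (funext fun p => map_add _ (ξ p) (ζ p))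
  map_smul' c ξ := Subtype.ext (funext fun p => map_smul _ c (ξ p))

lemma eval_rhoEnd {x : M} (σ : AdFiber B b x) (ξ : HermFiber B ρ x) (p : B.Fiber x) :
    AssocFiber.eval p (rhoEnd B b ρ σ ξ)
      = ρ.deriv (AssocFiber.eval p σ : b.LieAlg) (AssocFiber.eval p ξ) := rfl

/-- The bundle map `ρ_* : ad(P)_x → End(E_x)`. -/
def rhoStar (x : M) : AdFiber B b x →ₗ[ℝ] Module.End ℂ (HermFiber B ρ x) where
  toFun σ := rhoEnd B b ρ σ
  map_add' σ τ := by
    refine LinearMap.ext fun ξ => ?_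
    obtain ⟨p⟩ := PrincipalBundle.Fiber.nonempty (B := B) x
    apply AssocFiber.eval_injective p
    rw [LinearMap.add_apply, map_add, eval_rhoEnd, eval_rhoEnd, eval_rhoEnd, map_add]
    exact congrArg (fun T : V →L[ℂ] V => T (AssocFiber.eval p ξ))
      (map_add ρ.deriv (AssocFiber.eval p σ : b.LieAlg) (AssocFiber.eval p τ : b.LieAlg))
  map_smul' c σ := by
    refine LinearMap.ext fun ξ => ?_
    obtain ⟨p⟩ := PrincipalBundle.Fiber.nonempty (B := B) x
    apply AssocFiber.eval_injective p
    rw [LinearMap.smul_apply, LinearMap.map_smul_of_tower, eval_rhoEnd, eval_rhoEnd, map_smul]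
    exact congrArg (fun T : V →L[ℂ] V => T (AssocFiber.eval p ξ))
      (map_smul ρ.deriv c (AssocFiber.eval p σ : b.LieAlg))

end Rep

/-! ### Twisted spinors and the Dirac current -/

section Current


variable {n : ℕ} {M : Type*} [TopologicalSpace M] [ChartedSpace (Euc n) M]
  [IsManifold (𝓡 (2 * n)) ∞ M]
  [Bundle.RiemannianBundle (fun x : M => TangentSpace (𝓡 (2 * n)) x)]
  {o : ManifoldOrientation n M} {Q : Type*} [TopologicalSpace Q]
  {EG : Type*} [NormedAddCommGroup EG] [NormedSpace ℝ EG]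
  {G : Type*} [TopologicalSpace G] [ChartedSpace EG G] [Group G] [LieGroup 𝓘(ℝ, EG) ∞ G]
  {EP : Type*} [NormedAddCommGroup EP] [NormedSpace ℝ EP]
  {P : Type*} [TopologicalSpace P] [ChartedSpace EP P]
  {V : Type*} [NormedAddCommGroup V] [InnerProductSpace ℂ V]

variable (n EG EP) in
/-- A principal bundle over `M` is smooth if it has smooth local trivializations. -/
def PrincipalBundle.IsSmooth (B : PrincipalBundle G P M) : Prop :=
  ∀ x : M, ∃ (φ : OpenPartialHomeomorph P (M × G)) (U : Set M),
    x ∈ U ∧ IsLocalTrivialization B.proj B.act φ U ∧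
    ContMDiffOn 𝓘(ℝ, EP) ((𝓡 (2 * n)).prod 𝓘(ℝ, EG)) ∞ φ φ.source ∧
    ContMDiffOn ((𝓡 (2 * n)).prod 𝓘(ℝ, EG)) 𝓘(ℝ, EP) ∞ φ.symm φ.target

/-- The fibre over `x` of the bundle `ΣM ⊗ E` of twisted spinors, with its Hermitian metric
`⟨ψ ⊗ ξ, φ ⊗ ζ⟩ = ⟨ψ, φ⟩ ⟨ξ, ζ⟩`. -/
abbrev TwistedFiber (S : SpinStructure o Q) (B : PrincipalBundle G P M) (ρ : UnitaryRep EG G V)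
    (x : M) : Type _ := SpinorFiber S x ⊗[ℂ] HermFiber B ρ x

/-- A smooth local section of the spin bundle over `U`. Smoothness is read off from the orthonormal
frames, because `Q → SO(M, g)` is a local diffeomorphism. -/
structure IsSpinGauge (S : SpinStructure o Q) (U : Set M) (s : M → Q) : Prop where
  continuousOn : ContinuousOn s U
  proj_eq : ∀ x ∈ U, S.proj (s x) = x
  smooth : ∀ i, ContMDiffOn (𝓡 (2 * n)) (𝓡 (2 * n)).tangent ∞
    (fun x => (S.frame (s x)).vec (EuclideanSpace.single i 1)) U

variable (n EP) in
/-- A smooth local section of the principal bundle `P` over `U`. -/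
structure IsGauge (B : PrincipalBundle G P M) (U : Set M) (p : M → P) : Prop where
  smooth : ContMDiffOn (𝓡 (2 * n)) 𝓘(ℝ, EP) ∞ p U
  proj_eq : ∀ x ∈ U, B.proj (p x) = x

variable (EP) in
/-- The space `Γ(ΣM ⊗ E)` of smooth twisted spinors: in local gauges `s`, `p` they are smooth
functions with values in `Σ ⊗ V`. -/
structure TwistedSpinor (S : SpinStructure o Q) (B : PrincipalBundle G P M)
    (ρ : UnitaryRep EG G V) where
  val : ∀ x : M, TwistedFiber S B ρ x
  smooth : ∀ (U : Set M) (s : M → Q) (p : M → P), IsOpen U →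
    ∀ (hs : IsSpinGauge S U s) (hp : IsGauge n EP B U p) (f : M → Spinor n ⊗[ℂ] V),
      (∀ x (hx : x ∈ U), f x = TensorProduct.map
        (AssocFiber.eval (⟨s x, hs.proj_eq x hx⟩ : S.Fiber x))
        (AssocFiber.eval (⟨p x, hp.proj_eq x hx⟩ : B.Fiber x)) (val x)) →
      ContMDiffOn (𝓡 (2 * n)) 𝓘(ℝ, Spinor n ⊗[ℂ] V) ∞ f U

variable (S : SpinStructure o Q) (B : PrincipalBundle G P M) (b : AdInvariantMetric EG G)
  (ρ : UnitaryRep EG G V)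

/-- The fibre of the subbundle `Σ^ε M ⊗ E` of `ΣM ⊗ E`. -/
def chiralTwisted (ε : ℤˣ) (x : M) : Submodule ℂ (TwistedFiber S B ρ x) :=
  LinearMap.range ((S.chiral ε x).subtype.rTensor (HermFiber B ρ x))

/-- The operator `Ψ ↦ X · ρ_*(σ) Ψ` on twisted spinors; `X` acts on the first factor by Clifford
multiplication and `ρ_*(σ)` acts on the second factor. -/
def coupling {x : M} (X : TangentSpace (𝓡 (2 * n)) x) (σ : AdFiber B b x) :
    Module.End ℂ (TwistedFiber S B ρ x) :=
  (S.clifford x X).rTensor _ ∘ₗ (rhoStar B b ρ x σ).lTensor _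

/-- The coefficient `⟨Ψ, X · ρ_*(σ) Ψ⟩`. -/
def currentCoeff {x : M} (Ψ : TwistedFiber S B ρ x) (X : TangentSpace (𝓡 (2 * n)) x)
    (σ : AdFiber B b x) : ℂ := inner ℂ Ψ (coupling S B b ρ X σ Ψ)

instance (x : M) : FiniteDimensional ℝ (TangentSpace (𝓡 (2 * n)) x) :=
  inferInstanceAs (FiniteDimensional ℝ (Euc n))

/-- The expression `-½ ∑_{k, α} ⟨Ψ, e_k · ρ_*(σ_α) Ψ⟩ e^k ⊗ σ_α` in given orthonormal bases of
`T_x M` and `ad(P)_x`, as a linear map `T_x M → ad(P)_x`. The coefficients are real, because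
`X · ρ_*(σ)` is a Hermitian operator, so taking the real part loses nothing. -/
def frameCurrent {x : M} {ι κ : Type*} [Fintype ι] [Fintype κ] (Ψ : TwistedFiber S B ρ x)
    (e : OrthonormalBasis ι ℝ (TangentSpace (𝓡 (2 * n)) x))
    (τ : OrthonormalBasis κ ℝ (AdFiber B b x)) :
    TangentSpace (𝓡 (2 * n)) x →ₗ[ℝ] AdFiber B b x :=
  (-(1 / 2) : ℝ) • ∑ k, ∑ α, (currentCoeff S B b ρ Ψ (e k) (τ α)).re •
    (innerₗ (TangentSpace (𝓡 (2 * n)) x) (e k)).smulRight (τ α)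

lemma coupling_add_left {x : M} (X Y : TangentSpace (𝓡 (2 * n)) x) (σ : AdFiber B b x) :
    coupling S B b ρ (X + Y) σ = coupling S B b ρ X σ + coupling S B b ρ Y σ := by
  simp only [coupling, map_add, LinearMap.rTensor_add, LinearMap.add_comp]

lemma coupling_add_right {x : M} (X : TangentSpace (𝓡 (2 * n)) x) (σ τ : AdFiber B b x) :
    coupling S B b ρ X (σ + τ) = coupling S B b ρ X σ + coupling S B b ρ X τ := by
  simp only [coupling, map_add, LinearMap.lTensor_add, LinearMap.comp_add]

lemma coupling_smul_left {x : M} (c : ℝ) (X : TangentSpace (𝓡 (2 * n)) x) (σ : AdFiber B b x) :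
    coupling S B b ρ (c • X) σ = (c : ℂ) • coupling S B b ρ X σ := by
  have h : S.clifford x (c • X) = (c : ℂ) • S.clifford x X := map_smul _ _ _
  simp only [coupling, h, LinearMap.rTensor_smul, LinearMap.smul_comp]

lemma coupling_smul_right {x : M} (c : ℝ) (X : TangentSpace (𝓡 (2 * n)) x) (σ : AdFiber B b x) :
    coupling S B b ρ X (c • σ) = (c : ℂ) • coupling S B b ρ X σ := by
  have h : rhoStar B b ρ x (c • σ) = (c : ℂ) • rhoStar B b ρ x σ := map_smul _ _ _
  simp only [coupling, h, LinearMap.lTensor_smul, LinearMap.comp_smul]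

/-- The real bilinear form `(X, σ) ↦ ⟨Ψ, X · ρ_*(σ) Ψ⟩`. -/
def currentForm {x : M} (Ψ : TwistedFiber S B ρ x) :
    TangentSpace (𝓡 (2 * n)) x →ₗ[ℝ] AdFiber B b x →ₗ[ℝ] ℝ :=
  LinearMap.mk₂ ℝ (fun X σ => (currentCoeff S B b ρ Ψ X σ).re)
    (fun X Y σ => by simp [currentCoeff, coupling_add_left, inner_add_right])
    (fun c X σ => by
      rw [currentCoeff, coupling_smul_left, LinearMap.smul_apply, inner_smul_right,
        Complex.re_ofReal_mul]
      rfl)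
    (fun X σ τ => by simp [currentCoeff, coupling_add_right, inner_add_right])
    (fun c X σ => by
      rw [currentCoeff, coupling_smul_right, LinearMap.smul_apply, inner_smul_right,
        Complex.re_ofReal_mul]
      rfl)

lemma currentForm_apply {x : M} (Ψ : TwistedFiber S B ρ x) (X : TangentSpace (𝓡 (2 * n)) x)
    (σ : AdFiber B b x) : currentForm S B b ρ Ψ X σ = (currentCoeff S B b ρ Ψ X σ).re := rfl

lemma inner_frameCurrent {x : M} {ι κ : Type*} [Fintype ι] [Fintype κ]
    (Ψ : TwistedFiber S B ρ x) (e : OrthonormalBasis ι ℝ (TangentSpace (𝓡 (2 * n)) x))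
    (τ : OrthonormalBasis κ ℝ (AdFiber B b x)) (X : TangentSpace (𝓡 (2 * n)) x)
    (η : AdFiber B b x) :
    inner ℝ η (frameCurrent S B b ρ Ψ e τ X)
      = -(1 / 2) * (currentCoeff S B b ρ Ψ X η).re := by
  have h1 : currentForm S B b ρ Ψ X η = ∑ k, ∑ α, inner ℝ (e k) X *
      (inner ℝ (τ α) η * currentForm S B b ρ Ψ (e k) (τ α)) := by
    conv_lhs => rw [← e.sum_repr' X, ← τ.sum_repr' η]
    simp only [map_sum, LinearMap.sum_apply, map_smul, LinearMap.smul_apply, smul_eq_mul,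
      Finset.mul_sum]
    rw [Finset.sum_comm]
    refine Finset.sum_congr rfl fun k _ => Finset.sum_congr rfl fun α _ => ?_
    ring
  rw [← currentForm_apply, h1]
  simp only [frameCurrent, LinearMap.smul_apply, LinearMap.sum_apply, LinearMap.smulRight_apply,
    inner_smul_right, inner_sum, innerₗ_apply_apply, ← currentForm_apply]
  congr 1
  refine Finset.sum_congr rfl fun k _ => Finset.sum_congr rfl fun α _ => ?_
  rw [real_inner_comm η (τ α)]
  ring

/-- The expression for the current does not depend on the orthonormal bases. -/
lemma frameCurrent_eq {x : M} {ι κ ι' κ' : Type*} [Fintype ι] [Fintype κ] [Fintype ι'] [Fintype κ']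
    (Ψ : TwistedFiber S B ρ x) (e : OrthonormalBasis ι ℝ (TangentSpace (𝓡 (2 * n)) x))
    (τ : OrthonormalBasis κ ℝ (AdFiber B b x))
    (e' : OrthonormalBasis ι' ℝ (TangentSpace (𝓡 (2 * n)) x))
    (τ' : OrthonormalBasis κ' ℝ (AdFiber B b x)) :
    frameCurrent S B b ρ Ψ e τ = frameCurrent S B b ρ Ψ e' τ' := by
  refine LinearMap.ext fun X => ext_inner_left ℝ fun η => ?_
  rw [inner_frameCurrent, inner_frameCurrent]

variable {S B ρ}

/-- The Dirac current `J(Ψ) ∈ Ω¹(M; ad(P))`. By `frameCurrent_eq` it is given by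
`-½ ∑_{k, α} ⟨Ψ, e_k · ρ_*(σ_α) Ψ⟩ e^k ⊗ σ_α` in any orthonormal frames. -/
def diracCurrent [FiniteDimensional ℝ EG] (Ψ : TwistedSpinor EP S B ρ) (x : M) :
    TangentSpace (𝓡 (2 * n)) x →ₗ[ℝ] AdFiber B b x :=
  frameCurrent S B b ρ (Ψ.val x) (stdOrthonormalBasis ℝ _) (stdOrthonormalBasis ℝ _)

end Current

end DiracCurrent

end

open DiracCurrent

namespace DiracCurrent

attribute [local instance 2000] InnerProductSpace.toInner

/-! In even dimension, Clifford multiplication by a vector exchanges the two half-spinor spaces, and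
these are orthogonal to each other. So `X · φ` is orthogonal to `ψ` whenever `φ` and `ψ` have the
same chirality. The endomorphism `ρ_*(σ)` acts on the other tensor factor and leaves the chirality
alone, so the same orthogonality holds after twisting.

The algebra takes place in the model spinor module. Let `ω` be the complex volume element. It
anticommutes with every vector (`cliffordMul_mul_chirality`), since moving one `e_k` through `e₁ ⋯
e₂ₙ` produces `2n - 1` signs, and it is unitary (`inner_chirality_chirality`). If `ωψ = εψ` and `ωφ
= εφ` with `ε = ±1`, then `⟨ψ, vφ⟩ = ⟨ωψ, ωvφ⟩ = -⟨ωψ, vωφ⟩ = -ε²⟨ψ, vφ⟩ = -⟨ψ, vφ⟩`, so the product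
vanishes (`inner_cliffordMul_eq_zero`).

A spin frame carries this over to the fibres of the spinor bundle. A twisted spinor is a sum of
elementary tensors, and the cross terms between different summands matter. For this reason the
orthogonality is proved for two independent spinors of equal chirality, and not only for the
quadratic expression `⟨ψ, vψ⟩`. Once all coefficients vanish, so does the current. -/

/-! ### Clifford multiplication and chirality on the model spinor module -/

lemma cliffordMul_single {n : ℕ} (k : Fin (2 * n)) :
    cliffordMul n (EuclideanSpace.single k 1) = gamma k := by
  rw [cliffordMul_apply, Finset.sum_eq_single k]
  · simp
  · intro l _ hl
    simp [hl]
  · simp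

/-- Each factor different from `gamma k` contributes a sign and each equal factor contributes none.
The number of signs is the length minus the count, which has the same parity as the sum in the
exponent; the sum avoids truncated subtraction. Allowing arbitrary lists makes induction possible.
-/
lemma gamma_mul_prod_map {n : ℕ} (k : Fin (2 * n)) (L : List (Fin (2 * n))) :
    gamma k * (L.map gamma).prod
      = (-1 : ℂ) ^ (L.length + L.count k) • ((L.map gamma).prod * gamma k) := by
  induction L with
  | nil => simp
  | cons l L ih =>
    rw [List.map_cons, List.prod_cons, List.length_cons, List.count_cons]
    by_cases h : l = k
    · subst h
      rw [mul_assoc, ih]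
      simp only [beq_self_eq_true, if_true, mul_smul_comm]
      congr 1
      ring
    · have hkl : gamma k * gamma l = -(gamma l * gamma k) := by
        have := gamma_anticomm k l
        rw [if_neg (Ne.symm h), zero_smul] at this
        exact eq_neg_of_add_eq_zero_left this
      rw [← mul_assoc, hkl, neg_mul, mul_assoc, ih]
      simp only [beq_iff_eq, h, if_false, mul_smul_comm, mul_assoc, add_zero]
      rw [← neg_smul]
      congr 1
      ring

/-- Puts the volume element in the form of a product over a list of indices, where induction on the
list applies. -/
lemma chirality_eq (n : ℕ) :
    chirality n = Complex.I ^ n • ((List.finRange (2 * n)).map gamma).prod := by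
  simp only [chirality, cliffordMul_single, List.ofFn_eq_map]

/-- Clifford multiplication by a vector anticommutes with the complex volume element. -/
lemma cliffordMul_mul_chirality {n : ℕ} (v : Euc n) :
    cliffordMul n v * chirality n = -(chirality n * cliffordMul n v) := by
  -- Both sides are linear in `v`, so basis vectors suffice.
  have h (k : Fin (2 * n)) : gamma k * chirality n = -(chirality n * gamma k) := by
    have hc : (List.finRange (2 * n)).count k = 1 :=
      List.count_eq_one_of_mem (List.nodup_finRange _) (List.mem_finRange k)
    -- The even dimension enters here: length `2 * n` plus a single occurrence of `k` is odd. In odd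
    -- dimension the sign would be `+1` and the volume element would commute with vectors.
    have hs : (-1 : ℂ) ^ (2 * n + 1) = -1 := by simp [pow_succ, pow_mul]
    rw [chirality_eq, mul_smul_comm, gamma_mul_prod_map, hc, List.length_finRange, hs,
      smul_mul_assoc, neg_one_smul, smul_neg]
  simp only [cliffordMul_apply, Finset.sum_mul, Finset.mul_sum, smul_mul_assoc, mul_smul_comm, h,
    smul_neg, Finset.sum_neg_distrib]

/-- A skew-adjoint operator with square `-1` is an isometry. -/
lemma inner_gamma_gamma {n : ℕ} (k : Fin (2 * n)) (ψ φ : Spinor n) :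
    inner ℂ (gamma k ψ) (gamma k φ) = inner ℂ ψ φ := by
  -- The anticommutator of `gamma k` with itself is twice its square, hence the factor `2`, which is
  -- cancelled afterwards.
  have h : (2 : ℂ) • gamma k (gamma k φ) = (2 : ℂ) • -φ := by
    have := congrArg (fun T : Module.End ℂ (Spinor n) => T φ) (gamma_anticomm k k)
    simpa [two_smul, Module.End.mul_apply] using this
  rw [gamma_skew, smul_right_injective _ (two_ne_zero' ℂ) h, inner_neg_right, neg_neg]

/-- The complex volume element acts unitarily on spinors. -/
lemma inner_chirality_chirality {n : ℕ} (ψ φ : Spinor n) :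
    inner ℂ (chirality n ψ) (chirality n φ) = inner ℂ ψ φ := by
  have h (L : List (Fin (2 * n))) : inner ℂ ((L.map gamma).prod ψ) ((L.map gamma).prod φ)
      = inner ℂ ψ φ := by
    induction L with
    | nil => simp
    | cons k L ih => simp [Module.End.mul_apply, inner_gamma_gamma, ih]
  -- Of the normalisation `iⁿ` only its modulus `1` matters for unitarity.
  have hI : (starRingEnd ℂ) (Complex.I ^ n) * Complex.I ^ n = 1 := by
    rw [map_pow, ← mul_pow]
    simp
  rw [chirality_eq, LinearMap.smul_apply, LinearMap.smul_apply, inner_smul_left, inner_smul_right,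
    ← mul_assoc, hI, one_mul, h]

/-- `φ` has eigenvalue `ε` under the volume element while its Clifford product with `v` has
eigenvalue `-ε`, and a unitary operator has orthogonal eigenspaces. -/
lemma inner_cliffordMul_eq_zero {n : ℕ} {ε : ℤˣ} {ψ φ : Spinor n} (hψ : ψ ∈ chiralSpinors n ε)
    (hφ : φ ∈ chiralSpinors n ε) (v : Euc n) : inner ℂ ψ (cliffordMul n v φ) = 0 := by
  rw [chiralSpinors, Module.End.mem_eigenspace_iff] at hψ hφ
  have hv : chirality n (cliffordMul n v φ) = -cliffordMul n v (chirality n φ) := by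
    have := congrArg (fun T : Module.End ℂ (Spinor n) => T φ) (cliffordMul_mul_chirality v)
    simp only [Module.End.mul_apply, LinearMap.neg_apply] at this
    rw [this, neg_neg]
  have hε : (((ε : ℤ) : ℂ)) * ((ε : ℤ) : ℂ) = 1 := by
    rcases Int.units_eq_one_or ε with rfl | rfl <;> simp
  -- Evaluating the unitarity identity on these eigenvectors turns it into `-ε²⟨ψ, vφ⟩ = ⟨ψ, vφ⟩`;
  -- no conjugate survives because `ε` is an integer.
  have h := inner_chirality_chirality ψ (cliffordMul n v φ)
  rw [hv, hψ, hφ, map_smul, inner_neg_right, inner_smul_left, inner_smul_right, map_intCast,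
    ← mul_assoc, hε, one_mul] at h
  exact self_eq_neg.mp h.symm

/-! ### From the model to the fibres of the twisted spinor bundle -/

section Bundle

variable {n : ℕ} {M : Type*} [TopologicalSpace M] [ChartedSpace (Euc n) M]
  [IsManifold (𝓡 (2 * n)) ∞ M]
  [Bundle.RiemannianBundle (fun x : M => TangentSpace (𝓡 (2 * n)) x)]
  {o : ManifoldOrientation n M} {Q : Type*} [TopologicalSpace Q] (S : SpinStructure o Q)

/-- Clifford multiplication by a tangent vector maps spinors of chirality `ε` to spinors
orthogonal to all spinors of chirality `ε`. -/
lemma SpinStructure.inner_clifford_eq_zero {ε : ℤˣ} {x : M} {ψ φ : SpinorFiber S x}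
    (hψ : ψ ∈ S.chiral ε x) (hφ : φ ∈ S.chiral ε x) (X : TangentSpace (𝓡 (2 * n)) x) :
    inner ℂ ψ (S.clifford x X φ) = 0 := by
  -- Any spin frame `q` at `x` will do: it identifies the fibre isometrically with the model,
  -- matches the chirality condition, and turns `X` into its coordinate vector.
  obtain ⟨q⟩ := PrincipalBundle.Fiber.nonempty (B := S.toPrincipalBundle) x
  rw [AssocFiber.inner_eq _ _ q]
  exact inner_cliffordMul_eq_zero (hψ q) (hφ q) _

variable {EG : Type*} [NormedAddCommGroup EG] [NormedSpace ℝ EG]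
  {G : Type*} [TopologicalSpace G] [ChartedSpace EG G] [Group G] [LieGroup 𝓘(ℝ, EG) ∞ G]
  {P : Type*} [TopologicalSpace P]
  {V : Type*} [NormedAddCommGroup V] [InnerProductSpace ℂ V]
  (B : PrincipalBundle G P M) (b : AdInvariantMetric EG G) (ρ : UnitaryRep EG G V)

/-- On elementary tensors the coefficient factors as `⟨ψ, X · φ⟩ ⟨ξ, ρ_*(σ) ζ⟩`, and the first
factor already vanishes, whatever the second one is. -/
lemma currentCoeff_eq_zero {ε : ℤˣ} {x : M} {Ψ : TwistedFiber S B ρ x}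
    (hΨ : Ψ ∈ chiralTwisted S B ρ ε x) (X : TangentSpace (𝓡 (2 * n)) x) (σ : AdFiber B b x) :
    currentCoeff S B b ρ Ψ X σ = 0 := by
  -- The coefficient is quadratic in `Ψ`, so induction on a single tensor would leave cross terms.
  -- Two independent arguments make it additive in each. Working in the tensor product with the
  -- chiral subspace keeps the spinor factor of every elementary tensor chiral.
  suffices h : ∀ s t : S.chiral ε x ⊗[ℂ] HermFiber B ρ x,
      inner ℂ ((S.chiral ε x).subtype.rTensor (HermFiber B ρ x) s)
        (coupling S B b ρ X σ ((S.chiral ε x).subtype.rTensor (HermFiber B ρ x) t)) = 0 by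
    obtain ⟨s, rfl⟩ := hΨ
    exact h s s
  intro s t
  induction s with
  | zero => rw [map_zero, inner_zero_left]
  | add s₁ s₂ h₁ h₂ => rw [map_add, inner_add_left, h₁, h₂, add_zero]
  | tmul ψ ξ =>
    induction t with
    | zero => rw [map_zero, map_zero, inner_zero_right]
    | add t₁ t₂ h₁ h₂ => rw [map_add, map_add, inner_add_right, h₁, h₂, add_zero]
    | tmul φ ζ =>
      simp only [coupling, LinearMap.comp_apply, LinearMap.rTensor_tmul, LinearMap.lTensor_tmul,
        TensorProduct.inner_tmul, Submodule.subtype_apply]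
      rw [S.inner_clifford_eq_zero ψ.2 φ.2, zero_mul]

end Bundle

end DiracCurrent

theorem theorem1p1 {n : ℕ}
    -- the Riemannian spin manifold `M` of dimension `2 n`, with its spin structure `S`
    {M : Type*} [TopologicalSpace M] [ChartedSpace (Euc n) M] [IsManifold (𝓡 (2 * n)) ∞ M]
    [Bundle.RiemannianBundle (fun x : M => TangentSpace (𝓡 (2 * n)) x)]
    [IsContMDiffRiemannianBundle (𝓡 (2 * n)) ∞ (Euc n)
      (fun x : M => TangentSpace (𝓡 (2 * n)) x)]
    (o : ManifoldOrientation n M) {Q : Type*} [TopologicalSpace Q] (S : SpinStructure o Q)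
    -- the compact structure group `G`, with an invariant inner product on its Lie algebra
    {EG : Type*} [NormedAddCommGroup EG] [NormedSpace ℝ EG] [FiniteDimensional ℝ EG]
    {G : Type*} [TopologicalSpace G] [ChartedSpace EG G] [Group G] [LieGroup 𝓘(ℝ, EG) ∞ G]
    [CompactSpace G] (b : AdInvariantMetric EG G)
    -- the smooth principal bundle `G → P → M`
    {EP : Type*} [NormedAddCommGroup EP] [NormedSpace ℝ EP]
    {P : Type*} [TopologicalSpace P] [ChartedSpace EP P] [IsManifold 𝓘(ℝ, EP) ∞ P]
    (B : PrincipalBundle G P M) (_hB : B.IsSmooth n EG EP)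
    -- the unitary representation that defines the Hermitian bundle `E`
    {V : Type*} [NormedAddCommGroup V] [InnerProductSpace ℂ V] [FiniteDimensional ℂ V]
    (ρ : UnitaryRep EG G V)
    -- a smooth twisted spinor of chirality `ε`
    (Ψ : TwistedSpinor EP S B ρ) (ε : ℤˣ) (hΨ : ∀ x, Ψ.val x ∈ chiralTwisted S B ρ ε x) :
    diracCurrent b Ψ = 0 ∧
      ∀ (x : M) (X : TangentSpace (𝓡 (2 * n)) x) (σ : AdFiber B b x),
        currentCoeff S B b ρ (Ψ.val x) X σ = 0 := by
  have h (x : M) (X : TangentSpace (𝓡 (2 * n)) x) (σ : AdFiber B b x) :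
      currentCoeff S B b ρ (Ψ.val x) X σ = 0 := currentCoeff_eq_zero S B b ρ (hΨ x) X σ
  refine ⟨funext fun x => ?_, h⟩
  -- The current is a sum over frames whose coefficients are the real parts of numbers just shown to
  -- be zero, so it vanishes term by term.
  simp [diracCurrent, frameCurrent, h]
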